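/- Let $\omega_n>0$ $(n\ge 1)$ be real numbers. Put $B_{-1}=B_0=1$ and $B_m=B_{m-1}+\omega_mB_{m-2}$ for $m\ge1$. For $m\ge 0$ let $X_m$ be the symmetric tridiagonal $(m+1)\times(m+1)$ matrix with zero diagonal and off-diagonal entries $\sqrt{\omega_1},\dots,\sqrt{\omega_m}$, and let $G_m(i)$ be the upper-left entry of $(i-X_m)^{-1}$. The limits $G_{\mathrm{even}}=\lim_{m\to\infty} G_{2m}(i)$ and $G_{\mathrm{odd}}=\lim_{m\to\infty} G_{2m+1}(i)$ exist. The sequence $\{\omega_n\}_{n\ge1}$ has property (SC) if the following conditions, which are equivalent to one another, hold: (1) $G_{\mathrm{even}}\ne G_{\mathrm{odd}}$; (2) $\lim_{m\to\infty}\prod_{n=1}^m\left(1-\frac{B_{n-1}}{B_n}\right)>0$; (3) $\sum_{n=1}^\infty \frac{B_{n-1}}{B_n}<\infty$. A symmetric probability measure $\mu$ on $\mathbb R$ (that is, $\mu(-dx)=\mu(dx)$) has Jacobi sequence $\{\omega_n\}_{n\ge1}$ if all its moments are finite and its monic orthogonal polynomials $P_n$ (with $\deg P_n=n$, $\int P_mP_n\,d\mu=0$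 for $m\neq n$, $\int P_n^2\,d\mu>0$) satisfy $xP_n=P_{n+1}+\omega_nP_{n-1}$ for all $n\ge0$, where $P_{-1}=0$. **Proposition.** Let $p>2$ be a real number. Then the sequence $\{n^p\}_{n\ge1}$ has property (SC), with all of (1), (2), (3) holding. Moreover, there exist more than two symmetric probability measures on $\mathbb R$ whose Jacobi sequence is $\{n^p\}_{n\ge1}$. -/

import Mathlib

open MeasureTheory Filter Topology

/-! Sequences `ω = (ω 1, ω 2, …)` are functions `ℕ → ℝ`; the value `ω 0` is never used. -/

/-- The truncated Jacobi matrix `X_m`, of size `m + 1`: a symmetric tridiagonal matrix with zero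
diagonal and off-diagonal entries `√(ω 1), …, √(ω m)`. -/
noncomputable def jacobiMatrix (ω : ℕ → ℝ) (m : ℕ) : Matrix (Fin (m + 1)) (Fin (m + 1)) ℂ :=
  Matrix.of fun k l =>
    if (l : ℕ) = (k : ℕ) + 1 then ((√(ω l) : ℝ) : ℂ)
    else if (k : ℕ) = (l : ℕ) + 1 then ((√(ω k) : ℝ) : ℂ)
    else 0

/-- The Stieltjes transform at `i` of `X_m` in the state given by the basis vector `δ_0`:
the upper-left entry of `(i - X_m)⁻¹`. -/
noncomputable def stieltjesAtI (ω : ℕ → ℝ) (m : ℕ) : ℂ :=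
  (Complex.I • (1 : Matrix (Fin (m + 1)) (Fin (m + 1)) ℂ) - jacobiMatrix ω m)⁻¹ 0 0

/-- The sequence `B_m` with `B_{-1} = B_0 = 1` and `B_m = B_{m-1} + ω_m B_{m-2}` for `m ≥ 1`
(so `B_1 = 1 + ω_1`). -/
def jacobiB (ω : ℕ → ℝ) : ℕ → ℝ
  | 0 => 1
  | 1 => 1 + ω 1
  | (m + 2) => jacobiB ω (m + 1) + ω (m + 2) * jacobiB ω m

/-- Property (SC) of an infinite Jacobi sequence `ω 1, ω 2, … > 0`. The last three fields are
equivalent for every positive sequence, and any one of them is used to define the property;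
they are all recorded here. -/
structure PropertySC (ω : ℕ → ℝ) : Prop where
  /-- `ω` is an infinite Jacobi sequence. -/
  pos : ∀ n : ℕ, 1 ≤ n → 0 < ω n
  /-- `G_even ≠ G_odd`. -/
  even_ne_odd : ∃ Geven Godd : ℂ,
    Tendsto (fun m : ℕ => stieltjesAtI ω (2 * m)) atTop (𝓝 Geven) ∧
    Tendsto (fun m : ℕ => stieltjesAtI ω (2 * m + 1)) atTop (𝓝 Godd) ∧
    Geven ≠ Godd
  /-- `∏_{n ≥ 1} (1 - B_{n-1} / B_n) > 0`. -/
  prod_pos : ∃ L : ℝ, 0 < L ∧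
    Tendsto (fun m : ℕ => ∏ n ∈ Finset.range m, (1 - jacobiB ω n / jacobiB ω (n + 1)))
      atTop (𝓝 L)
  /-- `∑_{n ≥ 1} B_{n-1} / B_n < ∞`. -/
  sum_finite : ∃ S : ℝ,
    Tendsto (fun m : ℕ => ∑ n ∈ Finset.range m, jacobiB ω n / jacobiB ω (n + 1))
      atTop (𝓝 S)

/-- `α = (α 1, α 2, …)` and `ω = (ω 1, ω 2, …)` are the Jacobi sequences of the measure `μ`:
all moments of `μ` are finite, and the monic orthogonal polynomials `P_n` of `μ` satisfy
`x P_n = P_{n+1} + α_{n+1} P_n + ω_n P_{n-1}` with `P_{-1} = 0`. -/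
def HasJacobiSequences (μ : Measure ℝ) (α ω : ℕ → ℝ) : Prop :=
  (∀ n : ℕ, Integrable (fun x : ℝ => x ^ n) μ) ∧
  ∃ P : ℕ → Polynomial ℝ,
    (∀ n, (P n).Monic ∧ (P n).natDegree = n) ∧
    (∀ m n, m ≠ n → ∫ x, (P m).eval x * (P n).eval x ∂μ = 0) ∧
    (∀ n, 0 < ∫ x, (P n).eval x ^ 2 ∂μ) ∧
    Polynomial.X * P 0 = P 1 + Polynomial.C (α 1) * P 0 ∧
    ∀ n : ℕ, Polynomial.X * P (n + 1) =
      P (n + 2) + Polynomial.C (α (n + 2)) * P (n + 1) + Polynomial.C (ω (n + 1)) * P n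

/-- `μ` is a symmetric probability measure on `ℝ` with Jacobi sequence `ω` (the Jacobi
coefficients `α_n` of a symmetric measure all vanish). -/
structure IsSymmetricWithJacobi (μ : Measure ℝ) (ω : ℕ → ℝ) : Prop where
  prob : IsProbabilityMeasure μ
  symmetric : μ.map (fun x : ℝ => -x) = μ
  jacobi : HasJacobiSequences μ 0 ω

/-! Write Π_m for the m-th partial product of the factors 1 - B_{n-1}/B_n. The analytic core is that
Π_m, which decreases, stays above a positive constant. By telescoping, Π_m = ω_1⋯ω_m / (B_{m-1} B_m)
(`jacobiProd_eq`), so an upper bound on B_m is needed. After a WKB-type rescaling with f_n =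
(n+1)^(p/4), the recurrence for B becomes a perturbation of a two-step conservation law with error
1/(f_{n+1} f_{n+2}), which is summable because p > 2; a Gronwall estimate then bounds the rescaled
sequence (`exists_le_jacobiProd`).

Solving the tridiagonal system explicitly gives G_m(i) = -i ∑_{k≤m} (-1)^k Π_k
(`stieltjesAtI_eq_alternating`). Since Π_k decreases to L > 0, the even and odd limits exist and
differ by -iL.

For the measures, the spectral measure of X_m at δ_0 makes the polynomials of degree at most m
orthogonal, so each moment is eventually constant in m. Weak cluster points along even and along odd
m therefore solve the moment problem, and they satisfy ∫ 1/(1+x²) = -Im G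
(`exists_symmetric_isJacobiSolution`). This integral separates the two solutions from each other and
from their midpoint, which is the third measure. -/

/-- The sequence `jacobiB` started one step earlier: `shiftedB ω (m + 1) = B_m`,
`shiftedB ω 0 = B_{-1} = 1`. -/
noncomputable def shiftedB (ω : ℕ → ℝ) : ℕ → ℝ
  | 0 => 1
  | n + 1 => jacobiB ω n

lemma shiftedB_add_two (ω : ℕ → ℝ) (n : ℕ) :
    shiftedB ω (n + 2) = shiftedB ω (n + 1) + ω (n + 1) * shiftedB ω n := by
  cases n <;> simp [shiftedB, jacobiB]

/-! ### Lower bound for the products ∏ (1 - B_{n-1}/B_n) -/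

section Positive

variable {ω : ℕ → ℝ}

lemma jacobiB_pos (hω : ∀ n, 0 < ω (n + 1)) (n : ℕ) : 0 < jacobiB ω n := by
  have h : 0 < jacobiB ω n ∧ 0 < jacobiB ω (n + 1) := by
    induction n with
    | zero => exact ⟨one_pos, add_pos one_pos (hω 0)⟩
    | succ n ih => exact ⟨ih.2, add_pos ih.2 (mul_pos (hω (n + 1)) ih.1)⟩
  exact h.1

lemma shiftedB_pos (hω : ∀ n, 0 < ω (n + 1)) (n : ℕ) : 0 < shiftedB ω n := by
  cases n with
  | zero => exact one_pos
  | succ n => exact jacobiB_pos hω n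

/-- The partial products `∏_{n ≤ m} (1 - B_{n-1} / B_n)`. -/
noncomputable def jacobiProd (ω : ℕ → ℝ) (m : ℕ) : ℝ :=
  ∏ n ∈ Finset.range m, (1 - jacobiB ω n / jacobiB ω (n + 1))

lemma one_sub_jacobiB_div (hω : ∀ n, 0 < ω (n + 1)) (n : ℕ) :
    1 - jacobiB ω n / jacobiB ω (n + 1) = ω (n + 1) * shiftedB ω n / shiftedB ω (n + 2) := by
  have h := shiftedB_add_two ω n
  have h0 : 0 < shiftedB ω (n + 2) := shiftedB_pos hω _
  change 1 - shiftedB ω (n + 1) / shiftedB ω (n + 2) = _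
  field_simp
  linarith

/-- Each factor is ω_n B_{n-2}/B_n; the quotients jump by two indices, so the telescoping leaves two
denominators. -/
lemma jacobiProd_eq (hω : ∀ n, 0 < ω (n + 1)) (m : ℕ) :
    jacobiProd ω m =
      (∏ k ∈ Finset.range m, ω (k + 1)) / (shiftedB ω m * shiftedB ω (m + 1)) := by
  induction m with
  | zero => simp [jacobiProd, shiftedB, jacobiB]
  | succ m ih =>
    have h0 := (shiftedB_pos hω m).ne'
    have h1 := (shiftedB_pos hω (m + 1)).ne'
    have h2 := (shiftedB_pos hω (m + 2)).ne'
    rw [jacobiProd, Finset.prod_range_succ, ← jacobiProd, ih, one_sub_jacobiB_div hω,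
      Finset.prod_range_succ]
    field_simp

lemma jacobiProd_pos (hω : ∀ n, 0 < ω (n + 1)) (m : ℕ) : 0 < jacobiProd ω m := by
  rw [jacobiProd_eq hω]
  exact div_pos (Finset.prod_pos fun k _ => hω k)
    (mul_pos (shiftedB_pos hω _) (shiftedB_pos hω _))

lemma jacobiProd_antitone (hω : ∀ n, 0 < ω (n + 1)) : Antitone (jacobiProd ω) := by
  refine antitone_nat_of_succ_le fun m => ?_
  rw [jacobiProd, Finset.prod_range_succ, ← jacobiProd]
  refine mul_le_of_le_one_right (jacobiProd_pos hω m).le ?_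
  linarith [div_pos (jacobiB_pos hω m) (jacobiB_pos hω (m + 1))]

/-- If the partial products `∏ (1 - B_{n-1} / B_n)` are bounded below by a positive constant, they
converge to a positive limit. -/
lemma exists_tendsto_jacobiProd (hω : ∀ n, 0 < ω (n + 1)) {c : ℝ} (hc : 0 < c)
    (h : ∀ m, c ≤ jacobiProd ω m) :
    ∃ L : ℝ, 0 < L ∧ Tendsto (jacobiProd ω) atTop (𝓝 L) :=
  ⟨_, hc.trans_le (le_ciInf h),
    tendsto_atTop_ciInf (jacobiProd_antitone hω) ⟨c, by rintro _ ⟨m, rfl⟩; exact h m⟩⟩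

/-- The inequality 1 - x ≤ exp(-x) turns the lower bound c on the products into the upper bound -log
c on the partial sums. -/
lemma exists_tendsto_sum_jacobiB_div (hω : ∀ n, 0 < ω (n + 1)) {c : ℝ} (hc : 0 < c)
    (h : ∀ m, c ≤ jacobiProd ω m) :
    ∃ S : ℝ, Tendsto (fun m : ℕ => ∑ n ∈ Finset.range m, jacobiB ω n / jacobiB ω (n + 1))
      atTop (𝓝 S) := by
  have hnn : ∀ n, 0 ≤ jacobiB ω n / jacobiB ω (n + 1) := fun n =>
    (div_pos (jacobiB_pos hω n) (jacobiB_pos hω (n + 1))).le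
  refine ⟨_, (summable_of_sum_range_le (c := -Real.log c) hnn fun m => ?_).hasSum.tendsto_sum_nat⟩
  have h1 : c ≤ Real.exp (-∑ n ∈ Finset.range m, jacobiB ω n / jacobiB ω (n + 1)) := by
    refine (h m).trans ?_
    rw [← Finset.sum_neg_distrib, Real.exp_sum]
    refine Finset.prod_le_prod (fun n _ => ?_) fun n _ => ?_
    · rw [one_sub_jacobiB_div hω]
      exact div_nonneg (mul_nonneg (hω n).le (shiftedB_pos hω _).le) (shiftedB_pos hω _).le
    · linarith [Real.add_one_le_exp (-(jacobiB ω n / jacobiB ω (n + 1)))]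
  have h2 := Real.log_le_log hc h1
  rw [Real.log_exp] at h2
  linarith

/-- A positive lower bound on the products `∏ (1 - B_{n-1} / B_n)` for `ω` the fourth power of an
increasing log-concave sequence `f` with `∑ 1 / (f n * f (n + 1)) < ∞`. -/
lemma exists_le_jacobiProd {f : ℕ → ℝ} (hf : ∀ n, 0 < f n) (hωf : ∀ n, ω (n + 1) = f n ^ 4)
    (hmono : ∀ n, f n ≤ f (n + 1)) (hconc : ∀ n, f n * f (n + 2) ≤ f (n + 1) ^ 2)
    (hsum : Summable fun n => 1 / (f n * f (n + 1))) :
    ∃ c : ℝ, 0 < c ∧ ∀ m, c ≤ jacobiProd ω m := by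
  have hω : ∀ n, 0 < ω (n + 1) := fun n => by rw [hωf]; exact pow_pos (hf n) 4
  -- P n is the square root of ω_1⋯ω_n, and f n is the fourth root of ω_{n+1}.
  set P : ℕ → ℝ := fun n => ∏ k ∈ Finset.range n, f k ^ 2 with hP
  have hPpos : ∀ n, 0 < P n := fun n => Finset.prod_pos fun k _ => pow_pos (hf k) 2
  have hPs : ∀ n, P (n + 1) = P n * f n ^ 2 := fun n => Finset.prod_range_succ _ _
  -- P (n + 1) / f n is the expected order of growth of B_n, so τ should stay bounded.
  set τ : ℕ → ℝ := fun n => f n * jacobiB ω n / P (n + 1) with hτ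
  have hτpos : ∀ n, 0 < τ n := fun n =>
    div_pos (mul_pos (hf n) (jacobiB_pos hω n)) (hPpos _)
  set δ : ℕ → ℝ := fun n => 1 / (f (n + 1) * f (n + 2)) with hδ
  have hδpos : ∀ n, 0 < δ n := fun n => one_div_pos.2 (mul_pos (hf _) (hf _))
  set a : ℕ → ℝ := fun n => f (n + 1) / f n with ha
  have ha1 : ∀ n, 1 ≤ a n := fun n => (one_le_div (hf n)).2 (hmono n)
  have hapos : ∀ n, 0 < a n := fun n => one_pos.trans_le (ha1 n)
  have hanti : ∀ n, a (n + 1) ≤ a n := fun n => by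
    rw [ha]
    simp only
    rw [div_le_div_iff₀ (hf _) (hf _)]
    nlinarith [hconc n]
  -- With the weight a, the two-step term of the recurrence for B has coefficient exactly one; only
  -- the δ-term can make a·τ grow.
  have hrec : ∀ n, a (n + 1) * τ (n + 2) = a (n + 1) * δ n * τ (n + 1) + a n * τ n := fun n => by
    have e0 := (hf n).ne'
    have e1 := (hf (n + 1)).ne'
    have e2 := (hf (n + 2)).ne'
    have eP := (hPpos n).ne'
    have eB : jacobiB ω (n + 2) = jacobiB ω (n + 1) + f (n + 1) ^ 4 * jacobiB ω n := by
      rw [← hωf]; rfl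
    simp only [hτ, ha, hδ, hPs, eB, add_assoc, Nat.reduceAdd]
    field_simp
  set K : ℝ := a 0 * (τ 0 + τ 1) with hK
  have hKpos : 0 < K := mul_pos (hapos 0) (add_pos (hτpos 0) (hτpos 1))
  -- Discrete Gronwall on two consecutive terms carrying the same weight a n. Log-concavity (a
  -- decreasing) allows that weight to be replaced by the next one.
  have key : ∀ n, a n * τ n ≤ K * Real.exp (∑ k ∈ Finset.range n, δ k) ∧
      a n * τ (n + 1) ≤ K * Real.exp (∑ k ∈ Finset.range n, δ k) := by
    intro n
    induction n with
    | zero =>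
      simp only [Finset.range_zero, Finset.sum_empty, Real.exp_zero, mul_one, hK]
      exact ⟨mul_le_mul_of_nonneg_left (by linarith [hτpos 1]) (hapos 0).le,
        mul_le_mul_of_nonneg_left (by simpa using (hτpos 0).le) (hapos 0).le⟩
    | succ n ih =>
      rw [Finset.sum_range_succ, Real.exp_add]
      set E := K * Real.exp (∑ k ∈ Finset.range n, δ k) with hE
      have hEpos : 0 < E := mul_pos hKpos (Real.exp_pos _)
      have h1 : a (n + 1) * τ (n + 1) ≤ E :=
        (mul_le_mul_of_nonneg_right (hanti n) (hτpos _).le).trans ih.2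
      have h2 : E * (1 + δ n) ≤ K * (Real.exp (∑ k ∈ Finset.range n, δ k) * Real.exp (δ n)) := by
        rw [← mul_assoc, ← hE]
        exact mul_le_mul_of_nonneg_left (by linarith [Real.add_one_le_exp (δ n)]) hEpos.le
      refine ⟨?_, ?_⟩
      · nlinarith [mul_pos hEpos (hδpos n)]
      · have h3 := mul_le_mul_of_nonneg_left h1 (hδpos n).le
        have h4 := hrec n
        have h5 := ih.1
        refine le_trans ?_ h2
        change a (n + 1) * τ (n + 2) ≤ _
        nlinarith
  have hδsum : Summable δ := (summable_nat_add_iff 1).2 hsum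
  set M : ℝ := K * Real.exp (∑' k, δ k) with hM
  have hMpos : 0 < M := mul_pos hKpos (Real.exp_pos _)
  have hbd : ∀ n, K * Real.exp (∑ k ∈ Finset.range n, δ k) ≤ M := fun n =>
    mul_le_mul_of_nonneg_left (Real.exp_le_exp.2
      (hδsum.sum_le_tsum _ fun k _ => (hδpos k).le)) hKpos.le
  have hsucc : ∀ n, 1 / M ^ 2 ≤ jacobiProd ω (n + 1) := fun n => by
    have e0 := (hf n).ne'
    have e1 := (hf (n + 1)).ne'
    have eP := (hPpos n).ne'
    have eB0 := (jacobiB_pos hω n).ne'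
    have eB1 := (jacobiB_pos hω (n + 1)).ne'
    -- The scaling factors cancel up to a n, so bounding a n * τ n and τ (n + 1) by M each gives the
    -- constant 1 / M ^ 2.
    have e : jacobiProd ω (n + 1) = 1 / (a n * (τ n * τ (n + 1))) := by
      have hprod : ∏ k ∈ Finset.range (n + 1), ω (k + 1) = P (n + 1) ^ 2 := by
        rw [hP, ← Finset.prod_pow]
        exact Finset.prod_congr rfl fun k _ => by rw [hωf]; ring
      rw [jacobiProd_eq hω, hprod]
      change _ / (jacobiB ω n * jacobiB ω (n + 1)) = _
      simp only [hτ, ha, hPs]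
      field_simp
    rw [e]
    refine one_div_le_one_div_of_le
      (mul_pos (hapos n) (mul_pos (hτpos n) (hτpos (n + 1)))) ?_
    have h1 := (key n).1.trans (hbd n)
    have h2 : τ (n + 1) ≤ M :=
      (le_mul_of_one_le_left (hτpos _).le (ha1 n)).trans ((key n).2.trans (hbd n))
    calc a n * (τ n * τ (n + 1)) = (a n * τ n) * τ (n + 1) := by ring
      _ ≤ M * M := mul_le_mul h1 h2 (hτpos _).le hMpos.le
      _ = M ^ 2 := by ring
  exact ⟨_, one_div_pos.2 (pow_pos hMpos 2),
    fun m => (hsucc m).trans (jacobiProd_antitone hω (Nat.le_succ m))⟩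

end Positive

/-- Log-concavity of (n+1)^(p/4) reduces to (n+1)(n+3) ≤ (n+2)², and the error series is dominated
by ∑ n^(-p/2). Only this convergence needs p > 2; the rest uses p ≥ 0. -/
lemma exists_le_jacobiProd_rpow {p : ℝ} (hp : 2 < p) :
    ∃ c : ℝ, 0 < c ∧ ∀ m, c ≤ jacobiProd (fun n : ℕ => (n : ℝ) ^ p) m := by
  have hpos : ∀ n : ℕ, (0 : ℝ) < n + 1 := fun n => by positivity
  refine exists_le_jacobiProd (f := fun n : ℕ => ((n : ℝ) + 1) ^ (p / 4))
    (fun n => Real.rpow_pos_of_pos (hpos n) _) (fun n => ?_) (fun n => ?_) (fun n => ?_) ?_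
  · rw [← Real.rpow_natCast, ← Real.rpow_mul (hpos n).le]
    push_cast
    congr 1
    ring
  · push_cast
    exact Real.rpow_le_rpow (hpos n).le (by linarith) (by linarith)
  · have h := hpos n
    rw [← Real.rpow_natCast, ← Real.rpow_mul (hpos _).le, mul_comm (p / 4),
      Real.rpow_mul (hpos _).le, ← Real.mul_rpow (hpos _).le (hpos _).le]
    refine Real.rpow_le_rpow (mul_pos (hpos _) (hpos _)).le ?_ (by linarith)
    push_cast
    rw [Real.rpow_two]
    nlinarith
  · have hs : Summable fun n : ℕ => 1 / ((n + 1 : ℕ) : ℝ) ^ (p / 2) :=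
      (summable_nat_add_iff 1).2 (Real.summable_one_div_nat_rpow.2 (by linarith))
    refine Summable.of_nonneg_of_le (fun n => ?_) (fun n => ?_) hs
    · positivity
    · push_cast
      have e : ((n : ℝ) + 1) ^ (p / 2) = ((n : ℝ) + 1) ^ (p / 4) * ((n : ℝ) + 1) ^ (p / 4) := by
        rw [← Real.rpow_add (hpos n)]
        congr 1
        ring
      rw [e]
      have := hpos n
      gcongr
      linarith

/-! ### Eigenvectors of the truncated Jacobi matrix -/

section Matrix

variable (ω : ℕ → ℝ)

/-- The action of the Jacobi matrix on a vector given by a sequence vanishing at `m + 1`. -/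
lemma jacobiMatrix_mulVec (m : ℕ) (V : ℕ → ℂ) (hV : V (m + 1) = 0) (k : Fin (m + 1)) :
    (jacobiMatrix ω m).mulVec (fun l => V l) k =
      (if (k : ℕ) = 0 then 0 else ((√(ω k) : ℝ) : ℂ) * V (k - 1)) +
        ((√(ω (k + 1)) : ℝ) : ℂ) * V (k + 1) := by
  have hk := k.2
  rw [Matrix.mulVec, dotProduct]
  simp only [jacobiMatrix, Matrix.of_apply]
  rw [Fin.sum_univ_eq_sum_range (fun l : ℕ =>
    (if l = (k : ℕ) + 1 then ((√(ω l) : ℝ) : ℂ)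
    else if (k : ℕ) = l + 1 then ((√(ω k) : ℝ) : ℂ) else 0) * V l) (m + 1)]
  have e : ∀ l : ℕ, (if l = (k : ℕ) + 1 then ((√(ω l) : ℝ) : ℂ)
      else if (k : ℕ) = l + 1 then ((√(ω k) : ℝ) : ℂ) else 0) * V l =
      (if l = (k : ℕ) + 1 then ((√(ω l) : ℝ) : ℂ) * V l else 0) +
      (if l + 1 = (k : ℕ) then ((√(ω k) : ℝ) : ℂ) * V l else 0) := by
    intro l
    by_cases h1 : l = (k : ℕ) + 1
    · simp [h1]; intro h; omega
    · by_cases h2 : (k : ℕ) = l + 1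
      · rw [if_neg h1, if_neg h1, if_pos h2, if_pos h2.symm, zero_add]
      · simp [h1, h2, Ne.symm h2]
  simp only [e, Finset.sum_add_distrib]
  rw [add_comm]
  congr 1
  · split_ifs with h0
    · exact Finset.sum_eq_zero fun l _ => if_neg (by omega)
    · rw [Finset.sum_eq_single ((k : ℕ) - 1)]
      · rw [if_pos (by omega)]
      · intro l _ hl; exact if_neg (by omega)
      · intro hl; exact absurd (Finset.mem_range.2 (by omega)) hl
  · rw [Finset.sum_ite_eq']
    split_ifs with h
    · rfl
    · have : (k : ℕ) + 1 = m + 1 := by simp at h; omega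
      rw [this, hV, mul_zero]

lemma jacobiMatrix_isHermitian (m : ℕ) : (jacobiMatrix ω m).IsHermitian := by
  ext k l
  simp only [jacobiMatrix, Matrix.conjTranspose_apply, Matrix.of_apply]
  split_ifs with h1 h2 h3 <;> first | omega | simp

/-- The eigenvalues of the truncated Jacobi matrix. -/
noncomputable def jacobiNode (m : ℕ) (j : Fin (m + 1)) : ℝ :=
  (jacobiMatrix_isHermitian ω m).eigenvalues j

/-- The `k`-th coordinate of the `j`-th normalized eigenvector of the truncated Jacobi matrix,
extended by zero to all `k`. -/
noncomputable def jacobiVec (m : ℕ) (j : Fin (m + 1)) (k : ℕ) : ℂ :=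
  if h : k < m + 1 then (jacobiMatrix_isHermitian ω m).eigenvectorBasis j ⟨k, h⟩ else 0

lemma jacobiVec_coe (m : ℕ) (j k : Fin (m + 1)) :
    jacobiVec ω m j k = (jacobiMatrix_isHermitian ω m).eigenvectorBasis j k :=
  dif_pos k.2

/-- The extension by zero makes the last row k = m obey the same three-term relation as the others.
-/
lemma jacobiNode_mul_jacobiVec (m : ℕ) (j : Fin (m + 1)) {k : ℕ} (hk : k ≤ m) :
    (jacobiNode ω m j : ℂ) * jacobiVec ω m j k =
      (if k = 0 then 0 else ((√(ω k) : ℝ) : ℂ) * jacobiVec ω m j (k - 1)) +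
        ((√(ω (k + 1)) : ℝ) : ℂ) * jacobiVec ω m j (k + 1) := by
  have h := jacobiMatrix_mulVec ω m (jacobiVec ω m j) (by simp [jacobiVec]) ⟨k, by omega⟩
  rw [← h]
  have h2 := congrFun ((jacobiMatrix_isHermitian ω m).mulVec_eigenvectorBasis j) ⟨k, by omega⟩
  have h3 : (fun l : Fin (m + 1) => jacobiVec ω m j l) =
      ⇑((jacobiMatrix_isHermitian ω m).eigenvectorBasis j) := funext fun l => jacobiVec_coe ω m j l
  rw [h3, h2]
  simp [jacobiNode, jacobiVec, Nat.lt_succ_of_le hk]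

/-- Parseval for two standard basis vectors in the eigenbasis: the unitary matrix of eigenvectors
has orthonormal rows as well as columns. -/
lemma sum_conj_jacobiVec_mul (m : ℕ) {k l : ℕ} (hk : k ≤ m) (hl : l ≤ m) :
    ∑ j, (starRingEnd ℂ) (jacobiVec ω m j k) * jacobiVec ω m j l = if k = l then 1 else 0 := by
  have h := (jacobiMatrix_isHermitian ω m).eigenvectorBasis.sum_inner_mul_inner
    (EuclideanSpace.single (⟨l, by omega⟩ : Fin (m + 1)) (1 : ℂ))
    (EuclideanSpace.single (⟨k, by omega⟩ : Fin (m + 1)) (1 : ℂ))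
  rw [EuclideanSpace.inner_single_left] at h
  simp only [EuclideanSpace.inner_single_left, EuclideanSpace.inner_single_right] at h
  simp only [jacobiVec, Nat.lt_succ_of_le hk, Nat.lt_succ_of_le hl, dif_pos]
  simp only [map_one, one_mul] at h
  simp only [mul_comm] at h ⊢
  rw [h]
  simp [eq_comm]

end Matrix

/-! ### The resolvent entry at i -/

section Resolvent

variable (ω : ℕ → ℝ)

-- For Hermitian X the imaginary part of ⟨v, (i - X)v⟩ is ‖v‖², so the kernel is trivial.
open scoped ComplexOrder in
lemma isUnit_I_smul_one_sub_jacobiMatrix (m : ℕ) :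
    IsUnit (Complex.I • (1 : Matrix (Fin (m + 1)) (Fin (m + 1)) ℂ) - jacobiMatrix ω m) := by
  rw [← Matrix.mulVec_injective_iff_isUnit]
  refine (injective_iff_map_eq_zero (Matrix.mulVecLin _)).2 fun v hv => ?_
  rw [Matrix.mulVecLin_apply, Matrix.sub_mulVec, Matrix.smul_mulVec, Matrix.one_mulVec] at hv
  have h1 := congrArg (fun w => (star v ⬝ᵥ w).im) hv
  have h2 : (star v ⬝ᵥ (jacobiMatrix ω m).mulVec v).im = 0 :=
    (jacobiMatrix_isHermitian ω m).im_star_dotProduct_mulVec_self v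
  simp only [dotProduct_sub, dotProduct_smul, Complex.sub_im, h2, dotProduct_zero, sub_zero,
    smul_eq_mul, Complex.I_mul_im, Complex.zero_im] at h1
  have h3 : star v ⬝ᵥ v = 0 := by
    exact Complex.ext h1 (Complex.nonneg_iff.1 (dotProduct_star_self_nonneg v)).2.symm
  exact dotProduct_star_self_eq_zero.1 h3

/-- The entry of the resolvent is read off from any solution of the three-term system. -/
lemma stieltjesAtI_eq_of_solution (m : ℕ) (V : ℕ → ℂ) (hV : V (m + 1) = 0)
    (h : ∀ k ≤ m, Complex.I * V k - ((if k = 0 then 0 else ((√(ω k) : ℝ) : ℂ) * V (k - 1)) +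
        ((√(ω (k + 1)) : ℝ) : ℂ) * V (k + 1)) = if k = 0 then 1 else 0) :
    stieltjesAtI ω m = V 0 := by
  set A := Complex.I • (1 : Matrix (Fin (m + 1)) (Fin (m + 1)) ℂ) - jacobiMatrix ω m with hA
  have hdet : IsUnit A.det := (Matrix.isUnit_iff_isUnit_det A).1
    (isUnit_I_smul_one_sub_jacobiMatrix ω m)
  have hAV : A.mulVec (fun l : Fin (m + 1) => V l) = Pi.single 0 1 := by
    ext k
    rw [hA, Matrix.sub_mulVec, Matrix.smul_mulVec, Matrix.one_mulVec, Pi.sub_apply,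
      jacobiMatrix_mulVec ω m V hV, Pi.smul_apply, smul_eq_mul, h k (Nat.le_of_lt_succ k.2),
      Pi.single_apply]
    by_cases hk : k = 0
    · rw [if_pos hk, if_pos (by rw [hk]; rfl)]
    · rw [if_neg hk]
      exact if_neg fun h0 => hk (Fin.ext h0)
  have h2 : A⁻¹.mulVec (Pi.single 0 1) = fun l : Fin (m + 1) => V l := by
    rw [← hAV, Matrix.mulVec_mulVec, Matrix.nonsing_inv_mul A hdet, Matrix.one_mulVec]
  have h3 := congrFun h2 0
  rw [Matrix.mulVec_single_one] at h3
  exact h3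

/-- The spectral formula for the entry of the resolvent. -/
lemma stieltjesAtI_eq_sum (m : ℕ) :
    stieltjesAtI ω m =
      ∑ j, ((‖jacobiVec ω m j 0‖ ^ 2 : ℝ) : ℂ) * (Complex.I - jacobiNode ω m j)⁻¹ := by
  have hne : ∀ j, Complex.I - (jacobiNode ω m j : ℂ) ≠ 0 := fun j h => by
    simpa using congrArg Complex.im h
  -- The solution is (i - X)⁻¹ δ_0 expanded in the eigenbasis.
  rw [stieltjesAtI_eq_of_solution ω m (fun k => ∑ j, (starRingEnd ℂ) (jacobiVec ω m j 0) *
    jacobiVec ω m j k * (Complex.I - jacobiNode ω m j)⁻¹)]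
  · refine Finset.sum_congr rfl fun j _ => ?_
    rw [Complex.conj_mul']
    push_cast
    rfl
  · simp [jacobiVec]
  · intro k hk
    have h1 := sum_conj_jacobiVec_mul ω m (Nat.zero_le m) hk
    simp only [eq_comm (a := 0)] at h1
    rw [← h1]
    have h2 : ∀ j, (starRingEnd ℂ) (jacobiVec ω m j 0) * jacobiVec ω m j k =
        Complex.I * ((starRingEnd ℂ) (jacobiVec ω m j 0) *
          jacobiVec ω m j k * (Complex.I - jacobiNode ω m j)⁻¹) -
        ((if k = 0 then 0 else ((√(ω k) : ℝ) : ℂ) * ((starRingEnd ℂ) (jacobiVec ω m j 0) *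
          jacobiVec ω m j (k - 1) * (Complex.I - jacobiNode ω m j)⁻¹)) +
        ((√(ω (k + 1)) : ℝ) : ℂ) * ((starRingEnd ℂ) (jacobiVec ω m j 0) *
          jacobiVec ω m j (k + 1) * (Complex.I - jacobiNode ω m j)⁻¹)) := by
      intro j
      have h3 := jacobiNode_mul_jacobiVec ω m j hk
      have h4 := mul_inv_cancel₀ (hne j)
      split_ifs at h3 ⊢
      · linear_combination
          (-(starRingEnd ℂ) (jacobiVec ω m j 0) * jacobiVec ω m j k) * h4 -
            ((starRingEnd ℂ) (jacobiVec ω m j 0) * (Complex.I - jacobiNode ω m j)⁻¹) * h3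
      · linear_combination
          (-(starRingEnd ℂ) (jacobiVec ω m j 0) * jacobiVec ω m j k) * h4 -
            ((starRingEnd ℂ) (jacobiVec ω m j 0) * (Complex.I - jacobiNode ω m j)⁻¹) * h3
    rw [Finset.sum_congr rfl fun j _ => h2 j, Finset.sum_sub_distrib, Finset.sum_add_distrib,
      ← Finset.mul_sum, ← Finset.mul_sum]
    split_ifs
    · simp
    · rw [← Finset.mul_sum]

variable {ω}

/-- The entry of the resolvent as an alternating sum of the products `∏ (1 - B_{n-1} / B_n)`. -/
lemma stieltjesAtI_eq_alternating (hω : ∀ n, 0 < ω (n + 1)) (m : ℕ) :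
    stieltjesAtI ω m =
      -Complex.I * ((∑ k ∈ Finset.range (m + 1), (-1) ^ k * jacobiProd ω k : ℝ) : ℂ) := by
  set c : ℕ → ℝ := fun n => ∏ k ∈ Finset.range n, √(ω (k + 1)) with hc
  have hs : ∀ n, 0 < √(ω (n + 1)) := fun n => Real.sqrt_pos.2 (hω n)
  have hcpos : ∀ n, 0 < c n := fun n => Finset.prod_pos fun k _ => hs k
  have hcs : ∀ n, c (n + 1) = c n * √(ω (n + 1)) := fun n => Finset.prod_range_succ _ _
  -- I ^ n * q n is the n-th orthonormal polynomial at i, a solution of the homogeneous recurrence.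
  set q : ℕ → ℝ := fun n => shiftedB ω n / c n with hq
  have hqpos : ∀ n, 0 < q n := fun n => div_pos (shiftedB_pos hω n) (hcpos n)
  have hq1 : √(ω 1) * q 1 = q 0 := by
    have := (hs 0).ne'
    simp only [zero_add] at this
    simp [hq, hc, shiftedB, jacobiB]
    field_simp
  have hqrec : ∀ n, √(ω (n + 2)) * q (n + 2) = q (n + 1) + √(ω (n + 1)) * q n := fun n => by
    have e0 := (hs n).ne'
    have e1 := (hs (n + 1)).ne'
    have e2 := (hcpos n).ne'
    have e3 : √(ω (n + 1)) ^ 2 = ω (n + 1) := Real.sq_sqrt (hω n).le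
    simp only [hq, hcs, shiftedB_add_two, add_assoc, Nat.reduceAdd] at e1 ⊢
    field_simp
    linear_combination -shiftedB ω n * e3
  have hprod : ∀ n, jacobiProd ω n = 1 / (√(ω (n + 1)) * q n * q (n + 1)) := fun n => by
    have e0 := (hs n).ne'
    have e2 := (hcpos n).ne'
    have e3 := (shiftedB_pos hω n).ne'
    have e4 := (shiftedB_pos hω (n + 1)).ne'
    have e5 : ∏ k ∈ Finset.range n, ω (k + 1) = c n ^ 2 := by
      rw [hc, ← Finset.prod_pow]
      exact Finset.prod_congr rfl fun k _ => (Real.sq_sqrt (hω k).le).symm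
    rw [jacobiProd_eq hω, e5]
    simp only [hq, hcs]
    field_simp
  have hII : Complex.I ^ 2 = -1 := Complex.I_sq
  -- Reduction of order: the vector sought is I ^ k * q k * S k. Taking S to be a tail sum ending at
  -- m enforces the boundary condition at m + 1.
  set S : ℕ → ℂ := fun k =>
    -Complex.I * ((∑ l ∈ Finset.Ico k (m + 1), (-1) ^ l * jacobiProd ω l : ℝ) : ℂ) with hS
  have hSstep : ∀ k ≤ m, S k = S (k + 1) - Complex.I * ((-1) ^ k * (jacobiProd ω k : ℂ)) := by
    intro k hk
    simp only [hS]
    rw [Finset.sum_eq_sum_Ico_succ_bot (Nat.lt_succ_of_le hk)]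
    push_cast
    ring
  have hkey : ∀ k, ((√(ω (k + 1)) : ℝ) : ℂ) * (q k : ℂ) * (q (k + 1) : ℂ) *
      (jacobiProd ω k : ℂ) = 1 := by
    intro k
    rw [hprod]
    have := (mul_pos (mul_pos (hs k) (hqpos k)) (hqpos (k + 1))).ne'
    exact_mod_cast mul_one_div_cancel this
  have hqne : ∀ k, (q k : ℂ) ≠ 0 := fun k => by exact_mod_cast (hqpos k).ne'
  have hS0 : S 0 = -Complex.I *
      ((∑ k ∈ Finset.range (m + 1), (-1) ^ k * jacobiProd ω k : ℝ) : ℂ) := by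
    rw [Finset.range_eq_Ico]
  have hSm : S (m + 1) = 0 := by simp [hS]
  have hq0 : (q 0 : ℂ) = 1 := by simp [hq, hc, shiftedB]
  clear_value S q c
  rw [← hS0, stieltjesAtI_eq_of_solution ω m (fun k => Complex.I ^ k * (q k : ℂ) * S k)]
  · simp [hq0]
  · simp [hSm]
  · intro k hk
    have h1 := hSstep k hk
    have hk1 := hkey k
    cases k with
    | zero =>
      have hq1' : ((√(ω 1) : ℝ) : ℂ) * q 1 = q 0 := by exact_mod_cast hq1
      simp only [if_true, zero_add, pow_zero, pow_one] at *
      linear_combination (Complex.I * q 0) * h1 - Complex.I * S 1 * hq1' + hk1 -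
        q 0 * jacobiProd ω 0 * hq1' - q 0 * jacobiProd ω 0 * hII - q 0 * jacobiProd ω 0 * hq0
    | succ n =>
      have h2 := hSstep n (by omega)
      have hk0 := hkey n
      have hrec : ((√(ω (n + 2)) : ℝ) : ℂ) * q (n + 2) =
          q (n + 1) + ((√(ω (n + 1)) : ℝ) : ℂ) * q n := by exact_mod_cast hqrec n
      -- Both sides equal 1 / q (n + 1), by `hkey` at n and at n + 1.
      have hd : ((√(ω (n + 1)) : ℝ) : ℂ) * q n * jacobiProd ω n =
          ((√(ω (n + 2)) : ℝ) : ℂ) * q (n + 2) * jacobiProd ω (n + 1) := by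
        refine mul_left_cancel₀ (hqne (n + 1)) ?_
        linear_combination hk0 - hk1
      rw [if_neg (Nat.succ_ne_zero n), if_neg (Nat.succ_ne_zero n), Nat.add_sub_cancel]
      have h3 : S (n + 2) = S (n + 1) - Complex.I * ((-1) ^ n * (jacobiProd ω (n + 1) : ℂ)) := by
        rw [pow_succ] at h1
        linear_combination -h1
      change Complex.I * (Complex.I ^ (n + 1) * q (n + 1) * S (n + 1)) -
        (((√(ω (n + 1)) : ℝ) : ℂ) * (Complex.I ^ n * q n * S n) +
          ((√(ω (n + 2)) : ℝ) : ℂ) * (Complex.I ^ (n + 2) * q (n + 2) * S (n + 2))) = 0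
      rw [h2, h3]
      have e : Complex.I ^ (n + 2) = -Complex.I ^ n := by rw [pow_add, hII]; ring
      have e1 : Complex.I ^ (n + 1) = Complex.I * Complex.I ^ n := pow_succ' _ _
      rw [e, e1]
      linear_combination Complex.I ^ n * S (n + 1) * hrec + Complex.I ^ n * Complex.I * (-1) ^ n * hd +
        Complex.I ^ n * q (n + 1) * S (n + 1) * hII

end Resolvent

/-! ### The monic polynomials of the recurrence -/

section Polynomials

/-- The monic polynomials given by the three-term recurrence with coefficients `ω`. -/
noncomputable def jacobiPoly (ω : ℕ → ℝ) : ℕ → Polynomial ℝ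
  | 0 => 1
  | 1 => Polynomial.X
  | n + 2 => Polynomial.X * jacobiPoly ω (n + 1) - Polynomial.C (ω (n + 1)) * jacobiPoly ω n

variable (ω : ℕ → ℝ)

lemma X_mul_jacobiPoly (n : ℕ) : Polynomial.X * jacobiPoly ω (n + 1) =
    jacobiPoly ω (n + 2) + Polynomial.C (ω (n + 1)) * jacobiPoly ω n := by
  rw [jacobiPoly]; ring

lemma jacobiPoly_monic_natDegree (n : ℕ) :
    (jacobiPoly ω n).Monic ∧ (jacobiPoly ω n).natDegree = n := by
  have h : ((jacobiPoly ω n).Monic ∧ (jacobiPoly ω n).natDegree = n) ∧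
      ((jacobiPoly ω (n + 1)).Monic ∧ (jacobiPoly ω (n + 1)).natDegree = n + 1) := by
    induction n with
    | zero => simp [jacobiPoly, Polynomial.monic_X]
    | succ n ih =>
      refine ⟨ih.2, ?_⟩
      obtain ⟨⟨h1, h2⟩, h3, h4⟩ := ih
      have h5 : (Polynomial.X * jacobiPoly ω (n + 1)).Monic := Polynomial.monic_X.mul h3
      have h6 : (Polynomial.X * jacobiPoly ω (n + 1)).natDegree = n + 2 := by
        rw [Polynomial.monic_X.natDegree_mul h3, h4, Polynomial.natDegree_X]; omega
      have h7 : (Polynomial.C (ω (n + 1)) * jacobiPoly ω n).natDegree <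
          (Polynomial.X * jacobiPoly ω (n + 1)).natDegree := by
        rw [h6]
        exact (Polynomial.natDegree_C_mul_le _ _).trans_lt (by omega)
      have h8 : (Polynomial.C (ω (n + 1)) * jacobiPoly ω n).degree <
          (Polynomial.X * jacobiPoly ω (n + 1)).degree :=
        Polynomial.degree_lt_degree h7
      rw [jacobiPoly]
      exact ⟨h5.sub_of_left h8, by rw [Polynomial.natDegree_sub_eq_left_of_natDegree_lt h7, h6]⟩
  exact h.1

lemma jacobiPoly_comp_neg (n : ℕ) (x : ℝ) :
    (jacobiPoly ω n).eval (-x) = (-1) ^ n * (jacobiPoly ω n).eval x := by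
  have h : (jacobiPoly ω n).eval (-x) = (-1) ^ n * (jacobiPoly ω n).eval x ∧
      (jacobiPoly ω (n + 1)).eval (-x) = (-1) ^ (n + 1) * (jacobiPoly ω (n + 1)).eval x := by
    induction n with
    | zero => simp [jacobiPoly]
    | succ n ih =>
      refine ⟨ih.2, ?_⟩
      rw [jacobiPoly, Polynomial.eval_sub, Polynomial.eval_sub, Polynomial.eval_mul,
        Polynomial.eval_mul, Polynomial.eval_mul, Polynomial.eval_mul, ih.1, ih.2]
      simp only [Polynomial.eval_X, Polynomial.eval_C]
      ring
  exact h.1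

end Polynomials

/-! ### Spectral measures of the truncations -/

section SpectralMeasure

variable (ω : ℕ → ℝ)

/-- The spectral distribution of the truncated Jacobi matrix in the state `δ_0`. -/
noncomputable def jacobiMeasure (m : ℕ) : Measure ℝ :=
  ∑ j, ENNReal.ofReal (‖jacobiVec ω m j 0‖ ^ 2) • Measure.dirac (jacobiNode ω m j)

lemma integrable_jacobiMeasure {E : Type*} [NormedAddCommGroup E] (m : ℕ) (f : ℝ → E) :
    Integrable f (jacobiMeasure ω m) :=
  integrable_finsetSum_measure.2 fun _ _ =>
    (integrable_dirac enorm_lt_top).smul_measure ENNReal.ofReal_ne_top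

lemma integral_jacobiMeasure {E : Type*} [NormedAddCommGroup E] [NormedSpace ℝ E]
    [CompleteSpace E] (m : ℕ) (f : ℝ → E) :
    ∫ x, f x ∂(jacobiMeasure ω m) = ∑ j, (‖jacobiVec ω m j 0‖ ^ 2) • f (jacobiNode ω m j) := by
  rw [jacobiMeasure, integral_finsetSum_measure fun j _ =>
    (integrable_dirac enorm_lt_top).smul_measure ENNReal.ofReal_ne_top]
  refine Finset.sum_congr rfl fun j _ => ?_
  rw [integral_smul_measure, integral_dirac, ENNReal.toReal_ofReal (by positivity)]

instance jacobiMeasure_isProbabilityMeasure (m : ℕ) : IsProbabilityMeasure (jacobiMeasure ω m) := by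
  have h := sum_conj_jacobiVec_mul ω m (Nat.zero_le m) (Nat.zero_le m)
  simp only [Complex.conj_mul', if_true] at h
  have h1 : ∑ j, ‖jacobiVec ω m j 0‖ ^ 2 = 1 := by exact_mod_cast h
  refine ⟨?_⟩
  rw [jacobiMeasure, Measure.coe_finsetSum, Finset.sum_apply]
  simp only [Measure.smul_apply, measure_univ, smul_eq_mul, mul_one]
  rw [← ENNReal.ofReal_sum_of_nonneg fun j _ => by positivity, h1, ENNReal.ofReal_one]

lemma stieltjesAtI_eq_integral (m : ℕ) :
    stieltjesAtI ω m = ∫ x : ℝ, (Complex.I - (x : ℂ))⁻¹ ∂(jacobiMeasure ω m) := by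
  rw [stieltjesAtI_eq_sum, integral_jacobiMeasure]
  simp only [Complex.real_smul]

lemma im_stieltjesAtI (m : ℕ) :
    (stieltjesAtI ω m).im = -∫ x : ℝ, (1 + x ^ 2)⁻¹ ∂(jacobiMeasure ω m) := by
  rw [stieltjesAtI_eq_integral]
  have h := (integrable_jacobiMeasure ω m fun x : ℝ => (Complex.I - (x : ℂ))⁻¹)
  have h2 := integral_im h
  rw [← integral_neg]
  refine h2.symm.trans (integral_congr_ae (ae_of_all _ fun x => ?_))
  simp only [RCLike.im_to_complex, Complex.inv_im, Complex.sub_im, Complex.I_im, Complex.ofReal_im,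
    Complex.normSq_apply, Complex.sub_re, Complex.I_re, Complex.ofReal_re]
  rw [neg_div, sub_zero, one_div]
  congr 2
  ring

variable {ω}

/-- Both sides satisfy the same three-term recurrence in n with the same initial value: an
eigenvector is determined by its coordinate at 0. -/
lemma eval_jacobiPoly_mul_jacobiVec (hω : ∀ n, 0 < ω (n + 1)) (m : ℕ) (j : Fin (m + 1)) {n : ℕ}
    (hn : n ≤ m) :
    (((jacobiPoly ω n).eval (jacobiNode ω m j) : ℝ) : ℂ) * jacobiVec ω m j 0 =
      ((∏ k ∈ Finset.range n, √(ω (k + 1)) : ℝ) : ℂ) * jacobiVec ω m j n := by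
  have h : ∀ n, (n ≤ m → (((jacobiPoly ω n).eval (jacobiNode ω m j) : ℝ) : ℂ) *
      jacobiVec ω m j 0 = ((∏ k ∈ Finset.range n, √(ω (k + 1)) : ℝ) : ℂ) * jacobiVec ω m j n) ∧
      (n + 1 ≤ m → (((jacobiPoly ω (n + 1)).eval (jacobiNode ω m j) : ℝ) : ℂ) *
      jacobiVec ω m j 0 =
        ((∏ k ∈ Finset.range (n + 1), √(ω (k + 1)) : ℝ) : ℂ) * jacobiVec ω m j (n + 1)) := by
    intro n
    induction n with
    | zero =>
      refine ⟨fun _ => by simp [jacobiPoly], fun _ => ?_⟩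
      have h1 := jacobiNode_mul_jacobiVec ω m j (Nat.zero_le m)
      simpa [jacobiPoly] using h1
    | succ n ih =>
      refine ⟨ih.2, fun hm => ?_⟩
      have h1 := jacobiNode_mul_jacobiVec ω m j (show n + 1 ≤ m by omega)
      rw [if_neg (Nat.succ_ne_zero n), Nat.add_sub_cancel] at h1
      have h2 := ih.1 (by omega)
      have h3 := ih.2 (by omega)
      have h4 : ((√(ω (n + 1)) : ℝ) : ℂ) * ((√(ω (n + 1)) : ℝ) : ℂ) = (ω (n + 1) : ℂ) := by
        exact_mod_cast Real.mul_self_sqrt (hω n).le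
      simp only [jacobiPoly, Polynomial.eval_sub, Polynomial.eval_mul, Polynomial.eval_X,
        Polynomial.eval_C, Finset.prod_range_succ, Complex.ofReal_mul, Complex.ofReal_sub]
        at h2 h3 ⊢
      linear_combination (jacobiNode ω m j : ℂ) * h3 - (ω (n + 1) : ℂ) * h2 +
        ((∏ k ∈ Finset.range n, √(ω (k + 1)) : ℝ) : ℂ) * ((√(ω (n + 1)) : ℝ) : ℂ) * h1 +
        ((∏ k ∈ Finset.range n, √(ω (k + 1)) : ℝ) : ℂ) * jacobiVec ω m j n * h4
  exact (h n).1 hn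

/-- The polynomials `jacobiPoly ω n`, `n ≤ m`, are orthogonal for the `m`-th spectral measure. -/
lemma integral_jacobiPoly_mul (hω : ∀ n, 0 < ω (n + 1)) {m k l : ℕ} (hk : k ≤ m) (hl : l ≤ m) :
    ∫ x, (jacobiPoly ω k).eval x * (jacobiPoly ω l).eval x ∂(jacobiMeasure ω m) =
      if k = l then ∏ i ∈ Finset.range k, ω (i + 1) else 0 := by
  rw [integral_jacobiMeasure]
  have h : ∀ j, (((‖jacobiVec ω m j 0‖ ^ 2) • ((jacobiPoly ω k).eval (jacobiNode ω m j) *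
      (jacobiPoly ω l).eval (jacobiNode ω m j)) : ℝ) : ℂ) =
      ((∏ i ∈ Finset.range k, √(ω (i + 1)) : ℝ) : ℂ) *
        ((∏ i ∈ Finset.range l, √(ω (i + 1)) : ℝ) : ℂ) *
        ((starRingEnd ℂ) (jacobiVec ω m j k) * jacobiVec ω m j l) := fun j => by
    have h1 := congrArg (starRingEnd ℂ) (eval_jacobiPoly_mul_jacobiVec hω m j hk)
    have h2 := eval_jacobiPoly_mul_jacobiVec hω m j hl
    simp only [map_mul, Complex.conj_ofReal] at h1
    have h3 := Complex.conj_mul' (jacobiVec ω m j 0)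
    rw [smul_eq_mul]
    simp only [Complex.ofReal_mul, Complex.ofReal_pow]
    rw [← h3]
    linear_combination (((jacobiPoly ω l).eval (jacobiNode ω m j) : ℝ) : ℂ) *
      jacobiVec ω m j 0 * h1 + ((∏ i ∈ Finset.range k, √(ω (i + 1)) : ℝ) : ℂ) *
        (starRingEnd ℂ) (jacobiVec ω m j k) * h2
  rw [← Complex.ofReal_inj, Complex.ofReal_sum, Finset.sum_congr rfl fun j _ => h j,
    ← Finset.mul_sum, sum_conj_jacobiVec_mul ω m hk hl]
  split_ifs with hkl
  · subst hkl
    rw [mul_one, ← Complex.ofReal_mul, ← Finset.prod_mul_distrib]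
    exact congrArg _ (Finset.prod_congr rfl fun i _ => Real.mul_self_sqrt (hω i).le)
  · simp

/-- The moments of the spectral measures are eventually constant. -/
lemma exists_eventually_moment_eq (hω : ∀ n, 0 < ω (n + 1)) (k : ℕ) :
    ∃ M : ℝ, ∀ᶠ m in atTop, ∫ x, x ^ k ∂(jacobiMeasure ω m) = M := by
  -- The extra factor `jacobiPoly ω n` makes the induction work: multiplying it by x lowers k at the
  -- cost of moving n to its neighbours, and k = 0 is orthogonality to 1.
  have h : ∀ k n : ℕ, ∃ M : ℝ, ∀ᶠ m in atTop,
      ∫ x, x ^ k * (jacobiPoly ω n).eval x ∂(jacobiMeasure ω m) = M := by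
    intro k
    induction k with
    | zero =>
      intro n
      refine ⟨if 0 = n then ∏ i ∈ Finset.range 0, ω (i + 1) else 0, ?_⟩
      filter_upwards [eventually_ge_atTop n] with m hm
      rw [← integral_jacobiPoly_mul hω (Nat.zero_le m) hm]
      simp [jacobiPoly]
    | succ k ih =>
      intro n
      cases n with
      | zero =>
        obtain ⟨M, hM⟩ := ih 1
        refine ⟨M, hM.mono fun m hm => ?_⟩
        rw [← hm]
        simp [jacobiPoly, pow_succ]
      | succ n =>
        obtain ⟨M, hM⟩ := ih (n + 2)
        obtain ⟨N, hN⟩ := ih n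
        refine ⟨M + ω (n + 1) * N, ?_⟩
        filter_upwards [hM, hN] with m h1 h2
        rw [← h1, ← h2, ← integral_const_mul,
          ← integral_add (integrable_jacobiMeasure ω m _) (integrable_jacobiMeasure ω m _)]
        refine integral_congr_ae (ae_of_all _ fun x => ?_)
        simp only [jacobiPoly, Polynomial.eval_sub, Polynomial.eval_mul, Polynomial.eval_X,
          Polynomial.eval_C]
        ring
  obtain ⟨M, hM⟩ := h k 0
  exact ⟨M, hM.mono fun m hm => by rw [← hm]; simp [jacobiPoly]⟩

end SpectralMeasure

/-! ### Weak compactness and passage of moments to the limit -/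

section MethodOfMoments

/-- A sequence of probability measures on `ℝ` with bounded second moments has a weak cluster point,
which is a limit along an ultrafilter. -/
lemma exists_ultrafilter_tendsto_of_secondMoment_le (μ : ℕ → ProbabilityMeasure ℝ) {M : ℝ}
    (hint : ∀ n, Integrable (fun x : ℝ => x ^ 2) (μ n : Measure ℝ))
    (hM : ∀ᶠ n in atTop, ∫ x : ℝ, x ^ 2 ∂(μ n : Measure ℝ) ≤ M) :
    ∃ (ν : ProbabilityMeasure ℝ) (U : Ultrafilter ℕ), (U : Filter ℕ) ≤ atTop ∧
      Tendsto μ U (𝓝 ν) := by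
  set S : Set (ProbabilityMeasure ℝ) :=
    {ρ | Integrable (fun x : ℝ => x ^ 2) (ρ : Measure ℝ) ∧ ∫ x : ℝ, x ^ 2 ∂(ρ : Measure ℝ) ≤ M}
    with hS
  have htight : IsTightMeasureSet {((ρ : ProbabilityMeasure ℝ) : Measure ℝ) | ρ ∈ S} := by
    refine isTightMeasureSet_of_tendsto_measure_norm_gt ?_
    have hlim : Tendsto (fun r : ℝ => ENNReal.ofReal (M / r ^ 2)) atTop (𝓝 0) := by
      rw [← ENNReal.ofReal_zero]
      exact ENNReal.tendsto_ofReal (tendsto_const_nhds.div_atTop (tendsto_pow_atTop two_ne_zero))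
    refine tendsto_of_tendsto_of_tendsto_of_le_of_le' tendsto_const_nhds hlim
      (Eventually.of_forall fun _ => zero_le) ?_
    filter_upwards [eventually_gt_atTop 0] with r hr
    refine iSup₂_le ?_
    rintro _ ⟨ρ, ⟨h1, h2⟩, rfl⟩
    have h3 := mul_meas_ge_le_integral_of_nonneg (ae_of_all _ fun x => sq_nonneg x) h1 (r ^ 2)
    have h4 : (ρ : Measure ℝ).real {x | r ^ 2 ≤ x ^ 2} ≤ M / r ^ 2 := by
      rw [le_div_iff₀ (by positivity)]
      linarith
    refine (measure_mono fun x hx => ?_).trans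
      ((ENNReal.le_ofReal_iff_toReal_le (measure_ne_top _ _) ?_).2 h4)
    · have hx' : r < |x| := hx
      change r ^ 2 ≤ x ^ 2
      rw [← sq_abs x]
      exact pow_le_pow_left₀ hr.le hx'.le 2
    · exact measureReal_nonneg.trans h4
  have hcpt := isCompact_closure_of_isTightMeasureSet htight
  have hle : map μ atTop ≤ 𝓟 (closure S) := by
    rw [le_principal_iff]
    exact mem_map.2 (hM.mono fun n hn => subset_closure ⟨hint n, hn⟩)
  obtain ⟨ν, -, hν⟩ := hcpt hle
  obtain ⟨U, hU, hU'⟩ := mapClusterPt_iff_ultrafilter.1 hν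
  exact ⟨ν, U, hU, hU'⟩

variable {F : Filter ℕ} {μ : ℕ → ProbabilityMeasure ℝ} {ν : ProbabilityMeasure ℝ}

lemma tendsto_integral_of_continuous_bounded (h : Tendsto μ F (𝓝 ν)) {f : ℝ → ℝ}
    (hf : Continuous f) {C : ℝ} (hC : ∀ x, |f x| ≤ C) :
    Tendsto (fun n => ∫ x, f x ∂(μ n : Measure ℝ)) F (𝓝 (∫ x, f x ∂(ν : Measure ℝ))) :=
  ProbabilityMeasure.tendsto_iff_forall_integral_tendsto.1 h
    (BoundedContinuousFunction.ofNormedAddCommGroup f hf C hC)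

lemma integrable_of_continuous_bounded (ρ : Measure ℝ) [IsFiniteMeasure ρ] {f : ℝ → ℝ}
    (hf : Continuous f) {C : ℝ} (hC : ∀ x, |f x| ≤ C) : Integrable f ρ :=
  (BoundedContinuousFunction.ofNormedAddCommGroup f hf C hC).integrable ρ

variable [F.NeBot]

/-- Even moments pass to weak limits. -/
lemma integrable_even_pow_of_tendsto (h : Tendsto μ F (𝓝 ν)) (k : ℕ) {M : ℝ}
    (hint : ∀ n, Integrable (fun x : ℝ => x ^ (2 * k)) (μ n : Measure ℝ))
    (hM : ∀ᶠ n in F, ∫ x : ℝ, x ^ (2 * k) ∂(μ n : Measure ℝ) = M) :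
    Integrable (fun x : ℝ => x ^ (2 * k)) (ν : Measure ℝ) := by
  have hnn : ∀ x : ℝ, 0 ≤ x ^ (2 * k) := fun x => by rw [pow_mul]; positivity
  -- Continuous truncations of x^(2k), bounded by N + 1 and converging pointwise: weak convergence
  -- bounds their integrals by M, and Fatou removes the truncation.
  set g : ℕ → ℝ → ℝ := fun N x => x ^ (2 * k) / (1 + 1 / ((N : ℝ) + 1) * x ^ (2 * k)) with hg
  have hden : ∀ (N : ℕ) (x : ℝ), 1 ≤ 1 + 1 / ((N : ℝ) + 1) * x ^ (2 * k) := fun N x =>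
    le_add_of_nonneg_right (mul_nonneg (by positivity) (hnn x))
  have hg0 : ∀ N x, 0 ≤ g N x := fun N x =>
    div_nonneg (hnn x) (zero_le_one.trans (hden N x))
  have hgle : ∀ N x, g N x ≤ x ^ (2 * k) := fun N x => div_le_self (hnn x) (hden N x)
  have hgc : ∀ N, Continuous (g N) := fun N =>
    Continuous.div (by fun_prop) (by fun_prop) fun x => (zero_lt_one.trans_le (hden N x)).ne'
  have hgb : ∀ N x, |g N x| ≤ (N : ℝ) + 1 := fun N x => by
    rw [abs_of_nonneg (hg0 N x), div_le_iff₀ (zero_lt_one.trans_le (hden N x))]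
    have : ((N : ℝ) + 1) ≠ 0 := by positivity
    field_simp
    linarith [(Nat.cast_nonneg N : (0 : ℝ) ≤ N)]
  have hgM : ∀ N, ∫ x, g N x ∂(ν : Measure ℝ) ≤ M := fun N =>
    le_of_tendsto (tendsto_integral_of_continuous_bounded h (hgc N) (hgb N))
      (hM.mono fun n hn => hn ▸ integral_mono
        (integrable_of_continuous_bounded _ (hgc N) (hgb N)) (hint n) (hgle N))
  have hlim : ∀ x, Tendsto (fun N => ENNReal.ofReal (g N x)) atTop
      (𝓝 (ENNReal.ofReal (x ^ (2 * k)))) := fun x => by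
    refine ENNReal.tendsto_ofReal ?_
    have h1 : Tendsto (fun N : ℕ => 1 + 1 / ((N : ℝ) + 1) * x ^ (2 * k)) atTop
        (𝓝 (1 + 0 * x ^ (2 * k))) :=
      tendsto_const_nhds.add (tendsto_one_div_add_atTop_nhds_zero_nat.mul_const _)
    have h2 := (tendsto_const_nhds (x := x ^ (2 * k))).div h1 (by simp)
    rwa [zero_mul, add_zero, div_one] at h2
  have hfatou := lintegral_liminf_le (μ := (ν : Measure ℝ)) (u := (atTop : Filter ℕ))
    (f := fun N x => ENNReal.ofReal (g N x)) fun N => (hgc N).measurable.ennreal_ofReal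
  refine ⟨by fun_prop, ?_⟩
  rw [hasFiniteIntegral_iff_ofReal (ae_of_all _ hnn)]
  simp only [fun x => (hlim x).liminf_eq] at hfatou
  refine hfatou.trans_lt (lt_of_le_of_lt ?_ (ENNReal.ofReal_lt_top (r := M)))
  refine liminf_le_of_le (by isBoundedDefault) fun b hb => ?_
  obtain ⟨N, hN⟩ := hb.exists
  refine hN.trans ?_
  rw [← ofReal_integral_eq_lintegral_ofReal
    (integrable_of_continuous_bounded _ (hgc N) (hgb N)) (ae_of_all _ (hg0 N))]
  exact ENNReal.ofReal_le_ofReal (hgM N)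

/-- If the moments of `μ n` are eventually constant along `F`, then a weak limit along `F` has these
moments. -/
lemma integrable_pow_and_integral_pow_of_tendsto (h : Tendsto μ F (𝓝 ν))
    (hint : ∀ n k, Integrable (fun x : ℝ => x ^ k) (μ n : Measure ℝ)) {M : ℕ → ℝ}
    (hM : ∀ k, ∀ᶠ n in F, ∫ x : ℝ, x ^ k ∂(μ n : Measure ℝ) = M k) (k : ℕ) :
    Integrable (fun x : ℝ => x ^ k) (ν : Measure ℝ) ∧
      ∫ x : ℝ, x ^ k ∂(ν : Measure ℝ) = M k := by
  have heven : ∀ k, Integrable (fun x : ℝ => x ^ (2 * k)) (ν : Measure ℝ) := fun k =>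
    integrable_even_pow_of_tendsto h k (fun n => hint n _) (hM _)
  have hk : Integrable (fun x : ℝ => x ^ k) (ν : Measure ℝ) := by
    refine ((integrable_const (1 : ℝ)).add (heven k)).mono' (by fun_prop) (ae_of_all _ fun x => ?_)
    rw [Real.norm_eq_abs, Pi.add_apply, mul_comm, pow_mul, ← sq_abs]
    nlinarith [sq_nonneg (|x ^ k| - 1)]
  refine ⟨hk, ?_⟩
  have key : ∀ ε : ℝ, 0 < ε → |∫ x : ℝ, x ^ k ∂(ν : Measure ℝ) - M k| ≤
      ε * ((1 + ∫ x : ℝ, x ^ (2 * (3 * k)) ∂(ν : Measure ℝ)) + (1 + M (2 * (3 * k)))) := by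
    intro ε hε
    -- A bounded regularisation of x^k. Its error is at most ε|x^k|³ ≤ ε(1 + x^(6k)), hence
    -- controlled uniformly by the moment of order 6k.
    set f : ℝ → ℝ := fun x => x ^ k / (1 + ε * (x ^ k) ^ 2) with hf
    have hden : ∀ x : ℝ, 0 < 1 + ε * (x ^ k) ^ 2 := fun x => by positivity
    have hfc : Continuous f :=
      Continuous.div (by fun_prop) (by fun_prop) fun x => (hden x).ne'
    have hfb : ∀ x, |f x| ≤ 1 + 1 / ε := fun x => by
      rw [hf, abs_div, abs_of_pos (hden x), div_le_iff₀ (hden x), ← sq_abs (x ^ k)]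
      have h1 : (1 + 1 / ε) * (1 + ε * |x ^ k| ^ 2) =
          1 + |x ^ k| ^ 2 + (ε * |x ^ k| ^ 2 + 1 / ε) := by field_simp; ring
      rw [h1]
      have h2 : 0 ≤ ε * |x ^ k| ^ 2 + 1 / ε := by positivity
      nlinarith [sq_nonneg (|x ^ k| - 1)]
    have hdiff : ∀ x, |x ^ k - f x| ≤ ε * (1 + x ^ (2 * (3 * k))) := fun x => by
      have e : x ^ (2 * (3 * k)) = |x ^ k| ^ 6 := by
        rw [show 2 * (3 * k) = k * 6 by ring, pow_mul, Even.pow_abs (by decide)]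
      have e2 : x ^ k - f x = ε * (x ^ k) ^ 3 / (1 + ε * (x ^ k) ^ 2) := by
        have := (hden x).ne'
        simp only [hf]
        field_simp
        ring
      rw [e, e2, abs_div, abs_of_pos (hden x), abs_mul, abs_of_pos hε, abs_pow]
      refine (div_le_self (by positivity) (le_add_of_nonneg_right (by positivity))).trans ?_
      refine mul_le_mul_of_nonneg_left ?_ hε.le
      nlinarith [sq_nonneg (|x ^ k| ^ 3 - 1), sq_nonneg (|x ^ k| ^ 3)]
    have hbound : ∀ (ρ : Measure ℝ) [IsProbabilityMeasure ρ],
        Integrable (fun x : ℝ => x ^ k) ρ → Integrable (fun x : ℝ => x ^ (2 * (3 * k))) ρ →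
        |∫ x, x ^ k ∂ρ - ∫ x, f x ∂ρ| ≤ ε * (1 + ∫ x, x ^ (2 * (3 * k)) ∂ρ) := by
      intro ρ _ h1 h2
      have h3 := integrable_of_continuous_bounded ρ hfc hfb
      rw [← integral_sub h1 h3]
      refine (abs_integral_le_integral_abs).trans ?_
      refine (integral_mono (h1.sub h3).abs
        (((integrable_const (1 : ℝ)).add h2).const_mul ε) hdiff).trans ?_
      rw [integral_const_mul]
      simp only [Pi.add_apply]
      rw [integral_add (integrable_const _) h2]
      simp
    have h1 := hbound (ν : Measure ℝ) hk (heven _)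
    have h2 : |M k - ∫ x, f x ∂(ν : Measure ℝ)| ≤ ε * (1 + M (2 * (3 * k))) := by
      refine le_of_tendsto
        ((tendsto_const_nhds.sub (tendsto_integral_of_continuous_bounded h hfc hfb)).abs) ?_
      filter_upwards [hM k, hM (2 * (3 * k))] with n hn hn'
      rw [← hn, ← hn']
      exact hbound _ (hint n _) (hint n _)
    rw [mul_add]
    refine le_trans ?_ (add_le_add h1 h2)
    rw [abs_sub_comm (M k)]
    exact abs_sub_le _ _ _
  set C : ℝ := (1 + ∫ x : ℝ, x ^ (2 * (3 * k)) ∂(ν : Measure ℝ)) + (1 + M (2 * (3 * k)))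
  have hlim : Tendsto (fun ε : ℝ => ε * C) (𝓝[>] 0) (𝓝 0) := by
    have : Tendsto (fun ε : ℝ => ε * C) (𝓝 0) (𝓝 (0 * C)) := tendsto_id.mul_const C
    rw [zero_mul] at this
    exact this.mono_left nhdsWithin_le_nhds
  have h0 : |∫ x : ℝ, x ^ k ∂(ν : Measure ℝ) - M k| ≤ 0 :=
    ge_of_tendsto hlim (eventually_mem_nhdsWithin.mono fun ε hε => key ε hε)
  exact sub_eq_zero.1 (abs_nonpos_iff.1 h0)

lemma integrable_eval_of_integrable_pow {ρ : Measure ℝ}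
    (h : ∀ k : ℕ, Integrable (fun x : ℝ => x ^ k) ρ) (q : Polynomial ℝ) :
    Integrable (fun x => q.eval x) ρ := by
  simp only [Polynomial.eval_eq_sum_range]
  exact integrable_finsetSum _ fun i _ => (h i).const_mul _

/-- Eventual equality, rather than convergence, lets the orthogonality relations of the limit be
read off at a single n. -/
lemma eventually_integral_eval_eq_of_tendsto (h : Tendsto μ F (𝓝 ν))
    (hint : ∀ n k, Integrable (fun x : ℝ => x ^ k) (μ n : Measure ℝ)) {M : ℕ → ℝ}
    (hM : ∀ k, ∀ᶠ n in F, ∫ x : ℝ, x ^ k ∂(μ n : Measure ℝ) = M k) (q : Polynomial ℝ) :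
    ∀ᶠ n in F, ∫ x, q.eval x ∂(μ n : Measure ℝ) = ∫ x, q.eval x ∂(ν : Measure ℝ) := by
  have hν := integrable_pow_and_integral_pow_of_tendsto h hint hM
  have hev := (Finset.eventually_all (Finset.range (q.natDegree + 1))).2 fun k _ => hM k
  filter_upwards [hev] with n hn
  simp only [Polynomial.eval_eq_sum_range]
  rw [integral_finsetSum _ fun i _ => (hint n i).const_mul _,
    integral_finsetSum _ fun i _ => (hν i).1.const_mul _]
  refine Finset.sum_congr rfl fun i hi => ?_
  rw [integral_const_mul, integral_const_mul, hn i hi, (hν i).2]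

end MethodOfMoments

/-! ### Solutions of the moment problem and symmetrisation -/

section JacobiSolution

/-- `μ` is a probability measure with finite moments which makes the polynomials `jacobiPoly ω`
orthogonal with the squared norms prescribed by `ω`. -/
structure IsJacobiSolution (ω : ℕ → ℝ) (μ : Measure ℝ) : Prop where
  prob : IsProbabilityMeasure μ
  moments : ∀ n : ℕ, Integrable (fun x : ℝ => x ^ n) μ
  orthogonal : ∀ k l : ℕ, ∫ x, (jacobiPoly ω k).eval x * (jacobiPoly ω l).eval x ∂μ =
    if k = l then ∏ i ∈ Finset.range k, ω (i + 1) else 0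

/-- The average of two measures. -/
noncomputable def averageMeasure (μ ν : Measure ℝ) : Measure ℝ := (2⁻¹ : ENNReal) • (μ + ν)

lemma integral_averageMeasure {μ ν : Measure ℝ} {f : ℝ → ℝ} (hμ : Integrable f μ)
    (hν : Integrable f ν) :
    ∫ x, f x ∂(averageMeasure μ ν) = (∫ x, f x ∂μ + ∫ x, f x ∂ν) / 2 := by
  rw [averageMeasure, integral_smul_measure, integral_add_measure hμ hν]
  simp only [ENNReal.toReal_inv, ENNReal.toReal_ofNat, smul_eq_mul]
  ring

lemma map_neg_averageMeasure (μ ν : Measure ℝ) :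
    (averageMeasure μ ν).map (fun x : ℝ => -x) =
      averageMeasure (μ.map fun x : ℝ => -x) (ν.map fun x : ℝ => -x) := by
  rw [averageMeasure, averageMeasure, Measure.map_smul, Measure.map_add _ _ measurable_neg]

lemma integral_map_neg (μ : Measure ℝ) (f : ℝ → ℝ) :
    ∫ x, f x ∂(μ.map fun x : ℝ => -x) = ∫ x, f (-x) ∂μ :=
  (MeasurableEquiv.neg ℝ).measurableEmbedding.integral_map f

variable {ω : ℕ → ℝ} {μ ν : Measure ℝ}

namespace IsJacobiSolution

lemma integrable_mul (hμ : IsJacobiSolution ω μ) (k l : ℕ) :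
    Integrable (fun x => (jacobiPoly ω k).eval x * (jacobiPoly ω l).eval x) μ := by
  simpa only [Polynomial.eval_mul] using
    integrable_eval_of_integrable_pow hμ.moments (jacobiPoly ω k * jacobiPoly ω l)

lemma average (hμ : IsJacobiSolution ω μ) (hν : IsJacobiSolution ω ν) :
    IsJacobiSolution ω (averageMeasure μ ν) where
  prob := by
    have := hμ.prob
    have := hν.prob
    refine ⟨?_⟩
    simp only [averageMeasure, Measure.smul_apply, Measure.add_apply, measure_univ, smul_eq_mul]
    rw [one_add_one_eq_two, ENNReal.inv_mul_cancel two_ne_zero ENNReal.ofNat_ne_top]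
  moments n := ((hμ.moments n).add_measure (hν.moments n)).smul_measure
    (ENNReal.inv_ne_top.2 two_ne_zero)
  orthogonal k l := by
    rw [integral_averageMeasure (hμ.integrable_mul k l) (hν.integrable_mul k l), hμ.orthogonal,
      hν.orthogonal, add_self_div_two]

lemma map_neg (hμ : IsJacobiSolution ω μ) : IsJacobiSolution ω (μ.map fun x : ℝ => -x) where
  prob := by
    have := hμ.prob
    exact Measure.isProbabilityMeasure_map measurable_neg.aemeasurable
  moments n := by
    refine ((MeasurableEquiv.neg ℝ).measurableEmbedding.integrable_map_iff).2 ?_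
    have := (hμ.moments n).const_mul ((-1) ^ n)
    refine this.congr (ae_of_all _ fun x => ?_)
    exact (neg_pow x n).symm
  orthogonal k l := by
    rw [integral_map_neg, ← hμ.orthogonal k l]
    by_cases hkl : k = l
    · subst hkl
      refine integral_congr_ae (ae_of_all _ fun x => ?_)
      simp only [jacobiPoly_comp_neg]
      rw [mul_mul_mul_comm, ← mul_pow]
      simp
    · have h : ∀ x : ℝ, (jacobiPoly ω k).eval (-x) * (jacobiPoly ω l).eval (-x) =
          ((-1) ^ k * (-1) ^ l) * ((jacobiPoly ω k).eval x * (jacobiPoly ω l).eval x) := fun x => by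
        rw [jacobiPoly_comp_neg, jacobiPoly_comp_neg]; ring
      simp only [h]
      rw [integral_const_mul, hμ.orthogonal, if_neg hkl, mul_zero]

lemma isSymmetricWithJacobi (hμ : IsJacobiSolution ω μ) (hω : ∀ n, 0 < ω (n + 1))
    (hsymm : μ.map (fun x : ℝ => -x) = μ) : IsSymmetricWithJacobi μ ω where
  prob := hμ.prob
  symmetric := hsymm
  jacobi := by
    refine ⟨hμ.moments, jacobiPoly ω, jacobiPoly_monic_natDegree ω, fun m n hmn => ?_, fun n => ?_,
      ?_, fun n => ?_⟩
    · rw [hμ.orthogonal, if_neg hmn]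
    · simp only [sq]
      rw [hμ.orthogonal, if_pos rfl]
      exact Finset.prod_pos fun i _ => hω i
    · simp [jacobiPoly]
    · rw [X_mul_jacobiPoly]
      simp

end IsJacobiSolution

lemma integrable_inv_one_add_sq_of_isProbabilityMeasure [IsProbabilityMeasure μ] :
    Integrable (fun x : ℝ => (1 + x ^ 2)⁻¹) μ := by
  refine integrable_of_continuous_bounded μ (C := 1)
    (Continuous.inv₀ (by fun_prop) fun x => by positivity) fun x => ?_
  rw [abs_of_nonneg (by positivity)]
  exact inv_le_one_of_one_le₀ (by nlinarith [sq_nonneg x])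

/-- Every limit of a subsequence of `stieltjesAtI ω` comes from a symmetric measure with Jacobi
sequence `ω`. -/
lemma exists_symmetric_isJacobiSolution (hω : ∀ n, 0 < ω (n + 1)) {φ : ℕ → ℕ}
    (hφ : Tendsto φ atTop atTop) {G : ℂ}
    (hG : Tendsto (fun m => stieltjesAtI ω (φ m)) atTop (𝓝 G)) :
    ∃ ν : Measure ℝ, IsJacobiSolution ω ν ∧ ν.map (fun x : ℝ => -x) = ν ∧
      ∫ x : ℝ, (1 + x ^ 2)⁻¹ ∂ν = -G.im := by
  choose M hM using exists_eventually_moment_eq hω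
  set μ : ℕ → ProbabilityMeasure ℝ := fun n => ⟨jacobiMeasure ω (φ n), inferInstance⟩ with hμ
  have hint : ∀ n k, Integrable (fun x : ℝ => x ^ k) (μ n : Measure ℝ) := fun n k =>
    integrable_jacobiMeasure ω (φ n) _
  have hMφ : ∀ k, ∀ᶠ n in atTop, ∫ x : ℝ, x ^ k ∂(μ n : Measure ℝ) = M k := fun k =>
    hφ.eventually (hM k)
  obtain ⟨ν, U, hU, hν⟩ := exists_ultrafilter_tendsto_of_secondMoment_le μ
    (fun n => hint n 2) ((hMφ 2).mono fun n hn => hn.le)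
  have hMU : ∀ k, ∀ᶠ n in (U : Filter ℕ), ∫ x : ℝ, x ^ k ∂(μ n : Measure ℝ) = M k :=
    fun k => hU (hMφ k)
  have hsol : IsJacobiSolution ω (ν : Measure ℝ) := by
    refine ⟨inferInstance, fun n =>
      (integrable_pow_and_integral_pow_of_tendsto hν hint hMU n).1, fun k l => ?_⟩
    have h1 := eventually_integral_eval_eq_of_tendsto hν hint hMU (jacobiPoly ω k * jacobiPoly ω l)
    have h2 : ∀ᶠ n in (U : Filter ℕ), max k l ≤ φ n :=
      hU (hφ.eventually (eventually_ge_atTop (max k l)))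
    obtain ⟨n, hn1, hn2⟩ := (h1.and h2).exists
    simp only [Polynomial.eval_mul] at hn1
    rw [← hn1]
    exact integral_jacobiPoly_mul hω ((le_max_left k l).trans hn2) ((le_max_right k l).trans hn2)
  have hval : ∫ x : ℝ, (1 + x ^ 2)⁻¹ ∂(ν : Measure ℝ) = -G.im := by
    have h1 := tendsto_integral_of_continuous_bounded hν (f := fun x : ℝ => (1 + x ^ 2)⁻¹) (C := 1)
      (Continuous.inv₀ (by fun_prop) fun x => by positivity) fun x => by
        rw [abs_of_nonneg (by positivity)]
        exact inv_le_one_of_one_le₀ (by nlinarith [sq_nonneg x])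
    have h2 := (((Complex.continuous_im.tendsto G).comp hG).neg).mono_left hU
    refine tendsto_nhds_unique h1 (h2.congr fun n => ?_)
    simp only [Function.comp_apply, im_stieltjesAtI, neg_neg]
    rfl
  have hneg := hsol.map_neg
  -- Averaging with the reflection gives symmetry and keeps the value of ∫ 1/(1+x²), since the
  -- integrand is even.
  refine ⟨averageMeasure ν ((ν : Measure ℝ).map fun x : ℝ => -x), hsol.average hneg, ?_, ?_⟩
  · rw [map_neg_averageMeasure, Measure.map_map measurable_neg measurable_neg]
    have : (fun x : ℝ => -x) ∘ (fun x : ℝ => -x) = id := funext fun x => neg_neg x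
    rw [this, Measure.map_id, averageMeasure, averageMeasure, add_comm]
  · have := hneg.prob
    rw [integral_averageMeasure integrable_inv_one_add_sq_of_isProbabilityMeasure
      integrable_inv_one_add_sq_of_isProbabilityMeasure, integral_map_neg]
    simp only [neg_sq]
    rw [add_self_div_two, hval]

end JacobiSolution

/-! ### Separation of the two limits and conclusion -/

/-- If `∏ (1 - B_{n-1} / B_n)` is positive, then the even and odd subsequences of `stieltjesAtI ω`
converge to purely imaginary limits that differ. -/
lemma exists_tendsto_stieltjesAtI {ω : ℕ → ℝ} (hω : ∀ n, 0 < ω (n + 1)) {L : ℝ} (hL : 0 < L)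
    (h : Tendsto (jacobiProd ω) atTop (𝓝 L)) :
    ∃ Geven Godd : ℂ, Tendsto (fun m : ℕ => stieltjesAtI ω (2 * m)) atTop (𝓝 Geven) ∧
      Tendsto (fun m : ℕ => stieltjesAtI ω (2 * m + 1)) atTop (𝓝 Godd) ∧
      Geven.im ≠ Godd.im := by
  -- Leibniz's criterion needs terms tending to 0, so L is subtracted; the removed series ∑ (-1)^k L
  -- has partial sums alternating between L and 0.
  obtain ⟨l, hl⟩ := Antitone.tendsto_alternating_series_of_tendsto_zero
    (f := fun k => jacobiProd ω k - L)
    (fun a b hab => sub_le_sub_right (jacobiProd_antitone hω hab) L)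
    (by simpa using h.sub_const L)
  have hsum : ∀ m, ∑ k ∈ Finset.range m, (-1 : ℝ) ^ k * jacobiProd ω k =
      (∑ k ∈ Finset.range m, (-1 : ℝ) ^ k * (jacobiProd ω k - L)) +
        if Even m then 0 else L := by
    intro m
    induction m with
    | zero => simp
    | succ m ih =>
      rw [Finset.sum_range_succ, Finset.sum_range_succ, ih]
      by_cases hm : Even m
      · simp [hm, Nat.even_add_one, hm.neg_one_pow]
        ring
      · simp [hm, Nat.even_add_one, (Nat.not_even_iff_odd.1 hm).neg_one_pow]
        ring
  have hcont : ∀ a : ℝ, Tendsto (fun x : ℝ => -Complex.I * (x : ℂ)) (𝓝 a)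
      (𝓝 (-Complex.I * (a : ℂ))) := fun a =>
    Continuous.tendsto (by fun_prop) a
  -- An even index 2m gives an odd number 2m + 1 of terms, so the extra L belongs to the even limit.
  refine ⟨-Complex.I * ((l + L : ℝ) : ℂ), -Complex.I * (l : ℂ), ?_, ?_, ?_⟩
  · have h1 : Tendsto (fun m : ℕ => 2 * m + 1) atTop atTop :=
      tendsto_atTop_mono (fun m => by simp only [id]; omega) tendsto_id
    refine ((hcont _).comp ((hl.comp h1).add_const L)).congr fun m => ?_
    rw [stieltjesAtI_eq_alternating hω, hsum, if_neg (by simp)]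
    rfl
  · have h1 : Tendsto (fun m : ℕ => 2 * m + 1 + 1) atTop atTop :=
      tendsto_atTop_mono (fun m => by simp only [id]; omega) tendsto_id
    refine ((hcont _).comp (hl.comp h1)).congr fun m => ?_
    rw [stieltjesAtI_eq_alternating hω, hsum, if_pos (by simp [Nat.even_add_one]), add_zero]
    rfl
  · simp
    exact hL.ne'

theorem mainTheorem6 (p : ℝ) (hp : 2 < p) :
    PropertySC (fun n : ℕ => (n : ℝ) ^ p) ∧
    2 < {μ : Measure ℝ | IsSymmetricWithJacobi μ (fun n : ℕ => (n : ℝ) ^ p)}.encard := by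
  set ω : ℕ → ℝ := fun n : ℕ => (n : ℝ) ^ p with hωdef
  have hpos : ∀ n : ℕ, 1 ≤ n → 0 < ω n := fun n hn =>
    Real.rpow_pos_of_pos (by exact_mod_cast hn) p
  have hω : ∀ n, 0 < ω (n + 1) := fun n => hpos (n + 1) (Nat.le_add_left 1 n)
  obtain ⟨c, hc, hcle⟩ := exists_le_jacobiProd_rpow hp
  obtain ⟨L, hL, hLlim⟩ := exists_tendsto_jacobiProd hω hc hcle
  obtain ⟨G₀, G₁, h0, h1, hne⟩ := exists_tendsto_stieltjesAtI hω hL hLlim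
  refine ⟨⟨hpos, ⟨G₀, G₁, h0, h1, fun h => hne (by rw [h])⟩, ⟨L, hL, hLlim⟩,
    exists_tendsto_sum_jacobiB_div hω hc hcle⟩, ?_⟩
  obtain ⟨ν₀, hν₀, hs₀, hv₀⟩ := exists_symmetric_isJacobiSolution hω
    (tendsto_atTop_mono (fun m => by simp only [id]; omega) tendsto_id) h0
  obtain ⟨ν₁, hν₁, hs₁, hv₁⟩ := exists_symmetric_isJacobiSolution hω
    (tendsto_atTop_mono (fun m => by simp only [id]; omega) tendsto_id) h1
  have hv₂ : ∫ x : ℝ, (1 + x ^ 2)⁻¹ ∂(averageMeasure ν₀ ν₁) = (-G₀.im + -G₁.im) / 2 := by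
    have := hν₀.prob
    have := hν₁.prob
    rw [integral_averageMeasure integrable_inv_one_add_sq_of_isProbabilityMeasure
      integrable_inv_one_add_sq_of_isProbabilityMeasure, hv₀, hv₁]
  -- The values of ∫ 1/(1+x²) are two distinct numbers and their midpoint.
  have h01 : ν₀ ≠ ν₁ := fun h => hne (by rw [h] at hv₀; linarith)
  have h02 : ν₀ ≠ averageMeasure ν₀ ν₁ := fun h => hne (by rw [← h] at hv₂; linarith)
  have h12 : ν₁ ≠ averageMeasure ν₀ ν₁ := fun h => hne (by rw [← h] at hv₂; linarith)
  have hsub : ({ν₀, ν₁, averageMeasure ν₀ ν₁} : Set (Measure ℝ)) ⊆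
      {μ : Measure ℝ | IsSymmetricWithJacobi μ ω} := by
    rintro μ (rfl | rfl | rfl)
    · exact hν₀.isSymmetricWithJacobi hω hs₀
    · exact hν₁.isSymmetricWithJacobi hω hs₁
    · exact (hν₀.average hν₁).isSymmetricWithJacobi hω
        (by rw [map_neg_averageMeasure, hs₀, hs₁])
  refine lt_of_lt_of_le ?_ (Set.encard_le_encard hsub)
  rw [Set.encard_eq_three.2 ⟨_, _, _, h01, h02, h12, rfl⟩]
  norm_num
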